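/- For every positive integer $n$, let the Transposition graph $T_n$ be the Cayley graph of the symmetric group $\mathrm{Sym}_n$ with respect to the set of all transpositions; that is, its vertices are the permutations of $\{1,\dots,n\}$, and $g,h$ are adjacent if and only if $g^{-1}h$ is a transposition. The spectrum of $T_n$ consists of the eigenvalues of its adjacency matrix. If $n\ge 19$, then every integer in the interval $\left[-\frac{n-4}{2},\frac{n-4}{2}\right]$ lies in the spectrum of $T_n$, i.e. is an eigenvalue of the adjacency matrix of $T_n$. -/

import Mathlib

/-- The Transposition graph `T_n`: the Cayley graph of the symmetric group on `n` letters
generated by the set of all transpositions. -/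
def transpositionGraph (n : ℕ) : SimpleGraph (Equiv.Perm (Fin n)) :=
  SimpleGraph.mulCayley {σ : Equiv.Perm (Fin n) | σ.IsSwap}

open Classical in
/-- `μ` belongs to the spectrum of the finite graph `G`: it is an eigenvalue (over `ℝ`) of the
adjacency matrix of `G`. -/
def IsGraphEigenvalue {V : Type*} [Fintype V] (G : SimpleGraph V) (μ : ℝ) : Prop :=
  Module.End.HasEigenvalue (Matrix.toLin' (G.adjMatrix ℝ)) μ

/-!
The adjacency matrix of `T_n` acts on functions on `Sym_n`, read as elements of the group algebra,
as multiplication by the central element `J`, the sum of all transpositions. For a Young diagram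
`μ` with `n` cells, the Young symmetrizer `b * a` (`a` the row symmetrizer, `b` the column
antisymmetrizer) is an eigenvector whose eigenvalue is the sum of the contents `j - i` of the cells
`(i, j)`. This needs no representation theory. By centrality `b * a * J = b * J * a`, and the
transposition `(x y)` contributes to `b * J * a`

* `b * a` if `x` and `y` lie in one row, since `a` absorbs it;
* `-b * a` if they lie in one column, since `b` absorbs it with its sign;
* `0` otherwise (`columnAntisymmetrizer_mul_swap_mul_rowSymmetrizer`): the cell `z` in the row of
  the upper cell and the column of the lower one belongs to `μ`, and moving the row transposition
  of `x` and `z` across `(x y)` turns it into a column transposition.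

The coefficient of `b * a` at the identity is `1`, so it is nonzero, and counting pairs within rows
and within columns gives the sum of contents (`YoungDiagram.isGraphEigenvalue_content`).

It remains to find, for each `m` with `0 ≤ 2 * m ≤ n - 4`, a diagram with `n` cells and content sum
`m`; transposing it then yields `-m`. Build it from principal hooks. A self-conjugate hook of size
`2 * c + 1` adds nothing to the content sum, and a hook of arm `m` and leg `m - 1` has size `2 * m`
and adds `m`. Nested hooks must have distinct arms and distinct legs, so the self-conjugate hooks
can be chosen freely as long as their sizes are distinct odd numbers other than `2 * m - 1` and
`2 * m + 1`. If `n ≥ 19` and `n - 2 * m ≥ 4`, then `n - 2 * m` is a sum of at most three such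
numbers (`YoungDiagram.exists_hasDiagram`).
-/

open Equiv MonoidAlgebra

section Symmetrizer

/-! ### Row symmetrizers and column antisymmetrizers -/

variable {α : Type*} [Fintype α] [DecidableEq α]

/-- The sum in the group algebra of all permutations that preserve each fibre of `row`, a function
assigning to each letter the row in which it is written. -/
noncomputable def rowSymmetrizer (row : α → ℕ) : MonoidAlgebra ℝ (Perm α) :=
  ∑ σ : Perm α with ∀ x, row (σ x) = row x, MonoidAlgebra.of ℝ _ σ

/-- The signed sum in the group algebra of all permutations that preserve each fibre of `col`. -/
noncomputable def columnAntisymmetrizer (col : α → ℕ) : MonoidAlgebra ℝ (Perm α) :=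
  ∑ σ : Perm α with ∀ x, col (σ x) = col x,
    ((Perm.sign σ : ℤ) : ℝ) • MonoidAlgebra.of ℝ _ σ

open Classical in
variable (α) in
/-- The sum in the group algebra of all transpositions. -/
noncomputable def swapSum : MonoidAlgebra ℝ (Perm α) :=
  ∑ σ : Perm α with σ.IsSwap, MonoidAlgebra.of ℝ _ σ

lemma of_mul_rowSymmetrizer {row : α → ℕ} {τ : Perm α} (hτ : ∀ x, row (τ x) = row x) :
    MonoidAlgebra.of ℝ _ τ * rowSymmetrizer row = rowSymmetrizer row := by
  simp only [rowSymmetrizer, Finset.mul_sum, ← map_mul]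
  refine Finset.sum_equiv (Equiv.mulLeft τ) (fun σ => ?_) (fun σ _ => rfl)
  simp [hτ]

lemma columnAntisymmetrizer_mul_of {col : α → ℕ} {τ : Perm α} (hτ : ∀ x, col (τ x) = col x) :
    columnAntisymmetrizer col * MonoidAlgebra.of ℝ _ τ =
      ((Perm.sign τ : ℤ) : ℝ) • columnAntisymmetrizer col := by
  simp only [columnAntisymmetrizer, Finset.sum_mul, Finset.smul_sum, smul_mul_assoc, ← map_mul]
  refine Finset.sum_equiv (Equiv.mulRight τ) (fun σ => ?_) (fun σ _ => ?_)
  · simp only [Finset.mem_filter, Finset.mem_univ, true_and, Equiv.coe_mulRight, Perm.mul_apply]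
    refine ⟨fun h x => (h _).trans (hτ x), fun h x => ?_⟩
    obtain ⟨y, rfl⟩ := τ.surjective x
    rw [h y, hτ y]
  · rw [smul_smul]
    congr 1
    rcases Int.units_eq_one_or (Perm.sign τ) with h | h <;> simp [h]

/-- A transposition of letters in different rows and different columns vanishes between the two
symmetrizers, provided that the cell `z` completing the corner is present: the row transposition
`(x z)` is absorbed by the row symmetrizer and, once moved across `(x y)`, becomes the column
transposition `(y z)`, which the column antisymmetrizer absorbs with a sign. -/
lemma columnAntisymmetrizer_mul_swap_mul_rowSymmetrizer {row col : α → ℕ} {x y : α}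
    (hxy : row x < row y) (hcol : col x ≠ col y)
    (corner : ∃ z, row z = row x ∧ col z = col y) :
    columnAntisymmetrizer col * MonoidAlgebra.of ℝ _ (swap x y) * rowSymmetrizer row = 0 := by
  obtain ⟨z, hzr, hzc⟩ := corner
  have hzx : z ≠ x := by rintro rfl; exact hcol hzc
  have hzy : z ≠ y := by rintro rfl; omega
  have hx : ∀ t, row (swap x z t) = row t := by
    intro t; rw [swap_apply_def]; split_ifs with h1 h2 <;> simp [*]
  have hy : ∀ t, col (swap y z t) = col t := by
    intro t; rw [swap_apply_def]; split_ifs with h1 h2 <;> simp [*]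
  have hconj : swap x y * swap x z = swap y z * swap x y := by
    rw [swap_mul_eq_mul_swap (swap x y) y z, swap_inv, swap_apply_right,
      swap_apply_of_ne_of_ne hzx hzy]
  have key : columnAntisymmetrizer col * MonoidAlgebra.of ℝ _ (swap x y) * rowSymmetrizer row =
      -(columnAntisymmetrizer col * MonoidAlgebra.of ℝ _ (swap x y) * rowSymmetrizer row) := by
    conv_lhs => rw [← of_mul_rowSymmetrizer hx]
    rw [← mul_assoc, mul_assoc (columnAntisymmetrizer col), ← map_mul, hconj, map_mul, ← mul_assoc,
      columnAntisymmetrizer_mul_of hy, Perm.sign_swap hzy.symm]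
    simp
  have h2 : (2 : ℝ) • (columnAntisymmetrizer col * MonoidAlgebra.of ℝ _ (swap x y) *
      rowSymmetrizer row) = 0 := by
    rw [two_smul]
    exact add_eq_zero_iff_eq_neg.mpr key
  exact (smul_eq_zero.mp h2).resolve_left two_ne_zero

lemma of_mul_swapSum (τ : Perm α) :
    MonoidAlgebra.of ℝ _ τ * swapSum α = swapSum α * MonoidAlgebra.of ℝ _ τ := by
  classical
  simp only [swapSum, Finset.mul_sum, Finset.sum_mul, ← map_mul]
  refine Finset.sum_equiv (MulAut.conj τ).toEquiv (fun σ => ?_) (fun σ _ => ?_)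
  · simp only [Finset.mem_filter, Finset.mem_univ, true_and, MulEquiv.toEquiv_eq_coe,
      EquivLike.coe_coe, MulAut.conj_apply]
    simp only [← Perm.card_support_eq_two, Perm.card_support_conj]
  · simp

lemma rowSymmetrizer_mul_swapSum (row : α → ℕ) :
    rowSymmetrizer row * swapSum α = swapSum α * rowSymmetrizer row := by
  simp only [rowSymmetrizer, Finset.sum_mul, Finset.mul_sum, of_mul_swapSum]

lemma swap_injOn_lt {α : Type*} [DecidableEq α] {L : Type*} [LinearOrder L] {key : α → L}
    {p q : α × α}
    (hp : key p.1 < key p.2) (hq : key q.1 < key q.2) (h : swap p.1 p.2 = swap q.1 q.2) :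
    p = q := by
  obtain ⟨x, y⟩ := p
  obtain ⟨z, w⟩ := q
  simp only at hp hq h
  have hxy : x ≠ y := by rintro rfl; exact lt_irrefl _ hp
  have h1 : swap z w x = y := by rw [← h, swap_apply_left]
  rw [swap_apply_def] at h1
  split_ifs at h1 with h2 h3
  · rw [h1, h2]
  · subst h1 h3; exact absurd hp hq.asymm
  · exact absurd h1 hxy

/-- Each transposition is `swap x y` for exactly one pair with `key x < key y`. -/
lemma swapSum_eq_sum_lt {L : Type*} [LinearOrder L] {key : α → L}
    (hkey : Function.Injective key) :
    swapSum α = ∑ p : α × α with key p.1 < key p.2, MonoidAlgebra.of ℝ _ (swap p.1 p.2) := by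
  classical
  symm
  refine Finset.sum_bij (fun p _ => swap p.1 p.2) (fun p hp => ?_) (fun p hp q hq h => ?_)
    (fun σ hσ => ?_) (fun _ _ => rfl)
  · simp only [Finset.mem_filter, Finset.mem_univ, true_and] at hp ⊢
    exact ⟨p.1, p.2, fun h => hp.ne (congrArg key h), rfl⟩
  · simp only [Finset.mem_filter, Finset.mem_univ, true_and] at hp hq
    exact swap_injOn_lt hp hq h
  · simp only [Finset.mem_filter, Finset.mem_univ, true_and] at hσ
    obtain ⟨x, y, hxy, rfl⟩ := hσ
    rcases lt_or_gt_of_ne (hkey.ne hxy) with h | h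
    · exact ⟨(x, y), by simpa using h, rfl⟩
    · exact ⟨(y, x), by simpa using h, swap_comm _ _⟩

/-- The identity is the only element that preserves rows and columns, so it occurs in the Young
symmetrizer exactly once, with coefficient `1`. -/
lemma coeff_one_symmetrizer {row col : α → ℕ}
    (hinj : ∀ x y, row x = row y → col x = col y → x = y) :
    (columnAntisymmetrizer col * rowSymmetrizer row).coeff 1 = 1 := by
  have key : ∀ σ τ : Perm α, (∀ x, col (σ x) = col x) → (∀ x, row (τ x) = row x) →
      σ * τ = 1 → σ = 1 ∧ τ = 1 := by
    intro σ τ hσ hτ h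
    -- `τ` preserves rows, and `σ * τ = 1` makes it preserve columns too.
    have : τ = 1 := by
      ext1 x
      refine hinj _ _ (hτ x) ?_
      rw [← hσ (τ x), ← Perm.mul_apply, h]
    subst this
    exact ⟨by simpa using h, rfl⟩
  simp only [columnAntisymmetrizer, rowSymmetrizer, Finset.sum_mul, Finset.mul_sum,
    smul_mul_assoc, ← map_mul]
  simp only [MonoidAlgebra.coeff_sum, MonoidAlgebra.coeff_smul, MonoidAlgebra.of_apply,
    MonoidAlgebra.coeff_single, Finsupp.finsetSum_apply, Finsupp.smul_apply]
  rw [Finset.sum_eq_single 1, Finset.sum_eq_single 1]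
  · simp
  · intro σ hσ hne
    simp [hne]
  · simp
  · intro τ hτ hne
    refine Finset.sum_eq_zero fun σ hσ => ?_
    simp only [Finset.mem_filter, Finset.mem_univ, true_and] at hσ hτ
    rw [Finsupp.single_apply, if_neg fun h => hne (key _ _ hσ hτ h).2, smul_zero]
  · simp

/-- The Young symmetrizer is an eigenvector of the sum of all transpositions. Its eigenvalue is the
number of pairs in a common row minus the number of pairs in a common column. -/
lemma symmetrizer_mul_swapSum {row col : α → ℕ}
    (hinj : ∀ x y, row x = row y → col x = col y → x = y)
    (corner : ∀ x y, row x < row y → ∃ z, row z = row x ∧ col z = col y) :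
    columnAntisymmetrizer col * rowSymmetrizer row * swapSum α =
      (∑ y, ∑ x, ((if row x = row y ∧ col x < col y then 1 else 0) -
        (if col x = col y ∧ row x < row y then 1 else 0)) : ℝ) •
        (columnAntisymmetrizer col * rowSymmetrizer row) := by
  -- In the lexicographic order on cells, `x < y` in different rows means that `x` is in the upper
  -- row, which is what `corner` needs.
  have hkey : Function.Injective fun x => toLex (row x, col x) := fun x y h => by
    obtain ⟨h1, h2⟩ := Prod.ext_iff.mp (toLex.injective h)
    exact hinj x y h1 h2
  rw [mul_assoc, rowSymmetrizer_mul_swapSum, swapSum_eq_sum_lt hkey, Finset.sum_mul,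
    Finset.mul_sum, Finset.sum_smul]
  simp_rw [Finset.sum_smul]
  rw [Finset.sum_comm, ← Fintype.sum_prod_type', Finset.sum_filter]
  refine Finset.sum_congr rfl fun p _ => ?_
  obtain ⟨x, y⟩ := p
  simp only [Prod.Lex.toLex_lt_toLex]
  rcases lt_trichotomy (row x) (row y) with h | h | h
  · rw [if_pos (Or.inl h), ← mul_assoc]
    by_cases hc : col x = col y
    · have hswap : ∀ t, col (swap x y t) = col t := by
        intro t; rw [swap_apply_def]; split_ifs with h1 h2 <;> simp [*]
      rw [columnAntisymmetrizer_mul_of hswap, Perm.sign_swap (by rintro rfl; exact h.false)]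
      simp [hc, h, h.ne]
    · rw [columnAntisymmetrizer_mul_swap_mul_rowSymmetrizer h hc (corner x y h)]
      simp [hc, h.ne]
  · have hswap : ∀ t, row (swap x y t) = row t := by
      intro t; rw [swap_apply_def]; split_ifs with h1 h2 <;> simp [*]
    rw [of_mul_rowSymmetrizer hswap]
    by_cases hc : col x < col y <;> simp [h, hc]
  · simp [h.not_gt, h.ne']

end Symmetrizer

/-! ### Content sums are eigenvalues -/

/-- The content sum of a Young diagram: the sum of `j - i` over its cells `(i, j)`. -/
def YoungDiagram.content (μ : YoungDiagram) : ℤ := ∑ c ∈ μ.cells, ((c.2 : ℤ) - c.1)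

lemma YoungDiagram.card_left (μ : YoungDiagram) {c : ℕ × ℕ} (hc : c ∈ μ) :
    (μ.cells.filter fun d => d.1 = c.1 ∧ d.2 < c.2).card = c.2 := by
  have : (μ.cells.filter fun d => d.1 = c.1 ∧ d.2 < c.2) = {c.1} ×ˢ Finset.range c.2 := by
    ext ⟨i, j⟩
    simp only [Finset.mem_filter, Finset.mem_product, Finset.mem_singleton, Finset.mem_range,
      μ.mem_cells]
    refine ⟨And.right, fun h => ⟨μ.up_left_mem h.1.le h.2.le hc, h⟩⟩
  simp [this]

lemma YoungDiagram.card_above (μ : YoungDiagram) {c : ℕ × ℕ} (hc : c ∈ μ) :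
    (μ.cells.filter fun d => d.2 = c.2 ∧ d.1 < c.1).card = c.1 := by
  have : (μ.cells.filter fun d => d.2 = c.2 ∧ d.1 < c.1) = Finset.range c.1 ×ˢ {c.2} := by
    ext ⟨i, j⟩
    simp only [Finset.mem_filter, Finset.mem_product, Finset.mem_singleton, Finset.mem_range,
      μ.mem_cells]
    refine ⟨fun h => ⟨h.2.2, h.2.1⟩, fun h => ⟨μ.up_left_mem h.1.le h.2.le hc, h.2, h.1⟩⟩
  simp [this]

lemma YoungDiagram.sum_equiv_cells {ι : Type*} [Fintype ι] (μ : YoungDiagram) (e : ι ≃ μ.cells)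
    (f : ℕ × ℕ → ℝ) : ∑ x, f (e x) = ∑ c ∈ μ.cells, f c := by
  rw [← Finset.sum_coe_sort μ.cells f]
  exact Equiv.sum_comp e fun c => f c

/-- The adjacency matrix acts on coefficient functions as right multiplication by the sum of all
transpositions. -/
lemma adjMatrix_mulVec_coeff {n : ℕ} (v : MonoidAlgebra ℝ (Perm (Fin n)))
    [DecidableRel (transpositionGraph n).Adj] :
    ((transpositionGraph n).adjMatrix ℝ).mulVec v.coeff = (v * swapSum (Fin n)).coeff := by
  classical
  have hcoeff : ∀ (g τ : Perm (Fin n)),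
      (v * MonoidAlgebra.of ℝ _ τ).coeff g = v.coeff (g * τ⁻¹) := by
    intro g τ
    rw [MonoidAlgebra.of_apply, coeff_mul_single_eq_coeff_mul (g * τ⁻¹), mul_one]
    exact fun m _ => eq_mul_inv_iff_mul_eq.symm
  ext g
  rw [SimpleGraph.adjMatrix_mulVec_apply, swapSum, Finset.mul_sum, coeff_sum,
    Finsupp.finsetSum_apply]
  simp_rw [hcoeff]
  refine Finset.sum_bij (fun h _ => h⁻¹ * g) (fun h hh => ?_) (fun h _ h' _ heq => ?_)
    (fun τ hτ => ?_) (fun h _ => by simp)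
  · rw [SimpleGraph.mem_neighborFinset, transpositionGraph, SimpleGraph.mulCayley_adj'] at hh
    obtain ⟨-, s, hs, h1 | h1⟩ := hh
    · have : h⁻¹ * g = s⁻¹ := by rw [← h1]; group
      rw [this]
      obtain ⟨x, y, hxy, rfl⟩ := hs
      simpa using ⟨x, y, hxy, rfl⟩
    · simpa [h1] using hs
  · simpa using heq
  · simp only [Finset.mem_filter, Finset.mem_univ, true_and] at hτ
    refine ⟨g * τ⁻¹, ?_, by group⟩
    rw [SimpleGraph.mem_neighborFinset, transpositionGraph, SimpleGraph.mulCayley_adj']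
    refine ⟨fun h => ?_, τ, hτ, Or.inr (by group)⟩
    obtain ⟨x, y, hxy, rfl⟩ := hτ
    simp [hxy] at h

lemma isGraphEigenvalue_of_mulVec {V : Type*} [Fintype V] {G : SimpleGraph V}
    [DecidableRel G.Adj] {μ : ℝ} {v : V → ℝ} (hv : v ≠ 0)
    (h : (G.adjMatrix ℝ).mulVec v = μ • v) : IsGraphEigenvalue G μ := by
  classical
  refine Module.End.hasEigenvalue_of_hasEigenvector (x := v)
    (Module.End.hasEigenvector_iff.mpr ⟨Module.End.mem_eigenspace_iff.mpr ?_, hv⟩)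
  rw [Matrix.toLin'_apply, ← h]
  congr!

/-- The eigenvector is the Young symmetrizer of an arbitrary bijective filling of `μ`. -/
lemma YoungDiagram.isGraphEigenvalue_content (μ : YoungDiagram) :
    IsGraphEigenvalue (transpositionGraph μ.card) (μ.content : ℝ) := by
  classical
  let e : Fin μ.card ≃ μ.cells := μ.cells.equivFin.symm
  set row : Fin μ.card → ℕ := fun x => (e x).1.1 with hrow
  set col : Fin μ.card → ℕ := fun x => (e x).1.2 with hcol
  have hmem : ∀ x, (e x).1 ∈ μ := fun x => (e x).2
  have hinj : ∀ x y, row x = row y → col x = col y → x = y := fun x y h1 h2 =>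
    e.injective (Subtype.ext (Prod.ext h1 h2))
  have corner : ∀ x y, row x < row y → ∃ z, row z = row x ∧ col z = col y := fun x y h =>
    ⟨e.symm ⟨(row x, col y), μ.up_left_mem h.le le_rfl (hmem y)⟩, by simp [hrow], by simp [hcol]⟩
  have hsum : (∑ y, ∑ x, ((if row x = row y ∧ col x < col y then 1 else 0) -
        (if col x = col y ∧ row x < row y then 1 else 0)) : ℝ) = μ.content := by
    have hy : ∀ y, (∑ x, ((if row x = row y ∧ col x < col y then 1 else 0) -
        (if col x = col y ∧ row x < row y then 1 else 0)) : ℝ) = (col y : ℝ) - row y := by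
      intro y
      rw [μ.sum_equiv_cells e fun c => (if c.1 = row y ∧ c.2 < col y then 1 else 0) -
        (if c.2 = col y ∧ c.1 < row y then 1 else 0), Finset.sum_sub_distrib,
        Finset.sum_boole, Finset.sum_boole, μ.card_left (hmem y), μ.card_above (hmem y)]
    rw [Finset.sum_congr rfl fun y _ => hy y, μ.sum_equiv_cells e fun c => (c.2 : ℝ) - c.1,
      YoungDiagram.content]
    push_cast
    rfl
  set v := columnAntisymmetrizer col * rowSymmetrizer row with hv
  refine isGraphEigenvalue_of_mulVec (v := v.coeff) (fun h => ?_) ?_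
  · have h1 := coeff_one_symmetrizer hinj
    rw [← hv, h] at h1
    simp at h1
  · rw [adjMatrix_mulVec_coeff, hv, symmetrizer_mul_swapSum hinj corner, hsum]
    rfl

namespace YoungDiagram

/-- Transposing a diagram negates its content sum. -/
lemma isGraphEigenvalue_neg_content (μ : YoungDiagram) :
    IsGraphEigenvalue (transpositionGraph μ.card) ((-μ.content : ℤ) : ℝ) := by
  have hmap : μ.transpose.cells = μ.cells.map (Equiv.prodComm ℕ ℕ).toEmbedding := by
    ext c
    simp only [mem_cells, mem_transpose, Finset.mem_map_equiv]
    rfl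
  have hcard : μ.transpose.card = μ.card := by simp [YoungDiagram.card, hmap]
  have hcont : μ.transpose.content = -μ.content := by
    simp [content, hmap]
  rw [← hcont, ← hcard]
  exact μ.transpose.isGraphEigenvalue_content

/-! ### Diagrams built from principal hooks -/

/-- The diagonal shift of the cells of the grid by one step. -/
def shiftCell : ℕ × ℕ ↪ ℕ × ℕ :=
  ⟨fun c => (c.1 + 1, c.2 + 1), fun c d h => by simpa [Prod.ext_iff] using h⟩

lemma shiftCell_apply (c : ℕ × ℕ) : shiftCell c = (c.1 + 1, c.2 + 1) := rfl

/-- The diagram obtained from `μ` by shifting it diagonally and surrounding it by a hook with arm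
`a` and leg `b`, whose corner is the cell `(0, 0)`. -/
def addHook (μ : YoungDiagram) (a b : ℕ) (h : ∀ c ∈ μ, c.1 < b ∧ c.2 < a) : YoungDiagram where
  cells := ({0} ×ˢ Finset.range (a + 1) ∪ (Finset.Ico 1 (b + 1) ×ˢ {0})) ∪ μ.cells.map shiftCell
  isLowerSet := by
    rintro ⟨i, j⟩ ⟨i', j'⟩ ⟨hi, hj⟩ hc
    simp only [Finset.coe_union, Set.mem_union, Finset.mem_coe, Finset.mem_product,
      Finset.mem_singleton, Finset.mem_range, Finset.mem_Ico, Finset.mem_map, mem_cells,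
      shiftCell_apply, Prod.mk.injEq, Prod.exists] at hc hi hj ⊢
    rcases hc with (hc | hc) | ⟨k, l, hkl, rfl, rfl⟩
    · left; left; omega
    · left; omega
    · have := h _ hkl
      simp only at this
      rcases Nat.eq_zero_or_pos i' with h0 | h0
      · left; left; omega
      rcases Nat.eq_zero_or_pos j' with h1 | h1
      · left; right; omega
      right
      exact ⟨i' - 1, j' - 1, μ.up_left_mem (by omega) (by omega) hkl, by omega, by omega⟩

lemma sum_addHook {M : Type*} [AddCommMonoid M] (μ : YoungDiagram) {a b : ℕ}
    (h : ∀ c ∈ μ, c.1 < b ∧ c.2 < a) (f : ℕ × ℕ → M) :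
    ∑ c ∈ (μ.addHook a b h).cells, f c =
      (∑ j ∈ Finset.range (a + 1), f (0, j) + ∑ i ∈ Finset.range b, f (i + 1, 0)) +
        ∑ c ∈ μ.cells, f (c.1 + 1, c.2 + 1) := by
  rw [addHook, Finset.sum_union, Finset.sum_union, Finset.sum_map]
  · congr 2
    · simp
    · rw [Finset.sum_product, Finset.range_eq_Ico, Finset.sum_Ico_add' (fun i => f (i, 0)) 0 b 1]
      simp
  · refine Finset.disjoint_left.mpr fun c hc hc' => ?_
    simp only [Finset.mem_product, Finset.mem_singleton, Finset.mem_Ico] at hc hc'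
    omega
  · refine Finset.disjoint_left.mpr fun c hc hc' => ?_
    simp only [Finset.mem_map, shiftCell_apply] at hc'
    obtain ⟨d, -, rfl⟩ := hc'
    simp at hc

lemma card_addHook (μ : YoungDiagram) {a b : ℕ} (h : ∀ c ∈ μ, c.1 < b ∧ c.2 < a) :
    (μ.addHook a b h).card = μ.card + (a + b + 1) := by
  have := μ.sum_addHook h fun _ => 1
  simp only [Finset.sum_const, smul_eq_mul, mul_one, Finset.card_range] at this
  rw [YoungDiagram.card, this]
  ring

lemma two_mul_content_addHook (μ : YoungDiagram) {a b : ℕ} (h : ∀ c ∈ μ, c.1 < b ∧ c.2 < a) :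
    2 * (μ.addHook a b h).content = 2 * μ.content + (a * (a + 1) - b * (b + 1)) := by
  have gauss : ∀ n : ℕ, 2 * ∑ i ∈ Finset.range n, ((i : ℤ) + 1) = n * (n + 1) := by
    intro n
    induction n with
    | zero => simp
    | succ n ih => rw [Finset.sum_range_succ, mul_add, ih]; push_cast; ring
  have ha := gauss a
  have hb := gauss b
  rw [content, sum_addHook, Finset.sum_range_succ' _ a]
  have hrow : ∑ j ∈ Finset.range a, (((j + 1 : ℕ) : ℤ) - (0 : ℕ)) =
      ∑ j ∈ Finset.range a, ((j : ℤ) + 1) := by simp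
  have hcol : ∑ i ∈ Finset.range b, (((0 : ℕ) : ℤ) - (i + 1 : ℕ)) =
      -∑ i ∈ Finset.range b, ((i : ℤ) + 1) := by
    rw [← Finset.sum_neg_distrib]
    simp
  have hshift : ∑ c ∈ μ.cells, (((c.2 + 1 : ℕ) : ℤ) - (c.1 + 1 : ℕ)) = μ.content := by
    simp [content]
  rw [hrow, hcol, hshift]
  simp only [Nat.cast_zero, sub_zero]
  linarith

/-- There is a Young diagram with `n` cells and content sum `k` that fits into the `w × w` square.
The bound `w` records which hooks may still be placed around it. -/
def HasDiagram (n : ℕ) (k : ℤ) (w : ℕ) : Prop :=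
  ∃ μ : YoungDiagram, μ.card = n ∧ μ.content = k ∧ ∀ c ∈ μ, c.1 < w ∧ c.2 < w

lemma hasDiagram_zero : HasDiagram 0 0 0 :=
  ⟨⊥, by simp [YoungDiagram.card], by simp [content], by simp⟩

lemma HasDiagram.hook {n w : ℕ} {k : ℤ} (h : HasDiagram n k w) {a b : ℕ} (ha : w ≤ a) (hb : w ≤ b)
    {n' w' : ℕ} {k' : ℤ} (hn : n' = n + (a + b + 1))
    (hk : 2 * k' = 2 * k + (a * (a + 1) - b * (b + 1)))
    (hwa : a < w') (hwb : b < w') : HasDiagram n' k' w' := by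
  obtain ⟨μ, rfl, rfl, hμ⟩ := h
  have hbox : ∀ c ∈ μ, c.1 < b ∧ c.2 < a := fun c hc =>
    ⟨(hμ c hc).1.trans_le hb, (hμ c hc).2.trans_le ha⟩
  refine ⟨μ.addHook a b hbox, hn ▸ μ.card_addHook hbox, ?_, fun c hc => ?_⟩
  · have := μ.two_mul_content_addHook hbox
    linarith
  · rw [← mem_cells, addHook] at hc
    simp only [Finset.mem_union, Finset.mem_product, Finset.mem_singleton, Finset.mem_range,
      Finset.mem_Ico, Finset.mem_map, shiftCell_apply, mem_cells] at hc
    rcases hc with (hc | hc) | ⟨d, hd, rfl⟩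
    · omega
    · omega
    · have := hbox d hd
      simp only
      omega

/-- Surrounding a diagram by a self-conjugate hook keeps its content sum. -/
lemma HasDiagram.selfConjugateHook {n w : ℕ} {k : ℤ} (h : HasDiagram n k w) {c : ℕ} (hc : w ≤ c) :
    HasDiagram (n + (2 * c + 1)) k (c + 1) :=
  h.hook hc hc (by omega) (by ring) (by omega) (by omega)

/-- Surrounding a diagram by a hook with arm `m` and leg `m - 1` raises its content sum by `m`. -/
lemma HasDiagram.nearlySelfConjugateHook {n w : ℕ} {k : ℤ} (h : HasDiagram n k w) {m : ℕ}
    (hm : w + 1 ≤ m) : HasDiagram (n + 2 * m) (k + m) (m + 1) := by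
  refine h.hook (a := m) (b := m - 1) (by omega) (by omega) (by omega) ?_ (by omega) (by omega)
  rw [Nat.cast_sub (by omega)]
  push_cast
  ring

/-! ### Existence of a diagram with prescribed content sum -/

/-- The self-conjugate hooks have sizes that are distinct odd numbers with sum `n - 2 * m`. The
sizes `2 * m - 1` and `2 * m + 1` are excluded by the hook with arm `m` and leg `m - 1`, which is
placed outside the smaller ones and inside the larger ones. -/
lemma exists_hasDiagram (n : ℕ) (hn : 19 ≤ n) (m : ℕ) (hm : 2 * m + 4 ≤ n) :
    ∃ w, HasDiagram n m w := by
  have outer : ∀ {n' w : ℕ} {k : ℤ} {c : ℕ}, HasDiagram n' k w → w ≤ c →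
      n = n' + (2 * c + 1) → (m : ℤ) = k → ∃ w, HasDiagram n m w :=
    fun h hc h1 h2 => ⟨_, by rw [h1, h2]; exact h.selfConjugateHook hc⟩
  have outer' : ∀ {n' w : ℕ} {k : ℤ}, HasDiagram n' k w → w + 1 ≤ m → n = n' + 2 * m →
      (m : ℤ) = k + m → ∃ w, HasDiagram n m w :=
    fun h hc h1 h2 => ⟨_, by rw [h1, h2]; exact h.nearlySelfConjugateHook hc⟩
  -- Self-conjugate diagrams with one or two principal hooks.
  have one : ∀ c : ℕ, HasDiagram (0 + (2 * c + 1)) 0 (c + 1) := fun c =>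
    hasDiagram_zero.selfConjugateHook (by omega)
  have two : ∀ c d : ℕ, c < d → HasDiagram (0 + (2 * c + 1) + (2 * d + 1)) 0 (d + 1) :=
    fun c d h => (one c).selfConjugateHook h
  rcases Nat.eq_zero_or_pos m with rfl | hpos
  · obtain ⟨t, rfl | rfl⟩ := Nat.even_or_odd' n
    · exact outer (one 0) (c := t - 1) (by omega) (by omega) rfl
    · exact outer hasDiagram_zero (c := t) (by omega) (by omega) rfl
  have core : HasDiagram (0 + 2 * m) (0 + m) (m + 1) := hasDiagram_zero.nearlySelfConjugateHook hpos
  obtain ⟨r, rfl⟩ : ∃ r, n = r + 2 * m := ⟨n - 2 * m, by omega⟩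
  obtain ⟨t, rfl | rfl⟩ := Nat.even_or_odd' r
  -- `n - 2 * m = 2 * t`: two self-conjugate hooks, the smaller of size `1` unless `2 * t - 1` is
  -- excluded or `m = 1`, and then of size `3` or `5`.
  · rcases lt_or_ge t m with h | h
    · exact outer' (two 0 (t - 1) (by omega)) (by omega) (by omega) (by simp)
    rcases h.eq_or_lt with rfl | h
    · exact outer' (two 1 (m - 2) (by omega)) (by omega) (by omega) (by simp)
    rcases (Nat.succ_le_of_lt h).eq_or_lt with rfl | h
    · exact outer' (two 2 (m - 2) (by omega)) (by omega) (by omega) (by simp)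
    rcases (Nat.succ_le_of_lt hpos).eq_or_lt with rfl | hm1
    · exact outer (core.selfConjugateHook (c := 2) le_rfl) (c := t - 3) (by omega) (by omega)
        (by simp)
    · exact outer ((one 0).nearlySelfConjugateHook (m := m) (by omega)) (c := t - 1) (by omega)
        (by omega) (by simp)
  -- `n - 2 * m = 2 * t + 1`: a single self-conjugate hook, or, if its size is excluded, three of
  -- sizes `1`, `3` and `2 * t - 3`.
  · rcases lt_or_ge m t with h | h
    · exact outer core (c := t) (by omega) (by omega) (by simp)
    rcases lt_or_ge (t + 1) m with h' | h'
    · exact outer' (one t) (by omega) (by omega) (by simp)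
    · exact outer' ((two 0 1 (by omega)).selfConjugateHook (c := t - 2) (by omega)) (by omega)
        (by omega) (by simp)

end YoungDiagram

theorem theorem3 (n : ℕ) (hn : 19 ≤ n) (m : ℤ)
    (hm : (m : ℝ) ∈ Set.Icc (-(((n : ℝ) - 4) / 2)) (((n : ℝ) - 4) / 2)) :
    IsGraphEigenvalue (transpositionGraph n) (m : ℝ) := by
  obtain ⟨h1, h2⟩ := hm
  have h1' : -(n - 4 : ℤ) ≤ 2 * m := by
    have : -((n : ℝ) - 4) ≤ 2 * m := by linarith
    exact_mod_cast this
  have h2' : 2 * m ≤ (n - 4 : ℤ) := by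
    have : 2 * (m : ℝ) ≤ (n : ℝ) - 4 := by linarith
    exact_mod_cast this
  obtain ⟨w, μ, rfl, hμ, -⟩ := YoungDiagram.exists_hasDiagram n hn m.natAbs (by omega)
  rcases Int.natAbs_eq m with h | h
  · rw [h, ← hμ]
    exact μ.isGraphEigenvalue_content
  · rw [h, ← hμ]
    exact μ.isGraphEigenvalue_neg_content
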